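/- Let $d\ge 2$, let $\mathcal X,\mathcal Y\subset\mathbb R^d$ be Borel sets (for instance $\mathcal X=\mathcal Y=\mathbb R^d$), and let $\mu$ and $\nu$ be Borel probability measures on $\mathcal X$ and $\mathcal Y$. Assume that $\mu$ is absolutely continuous with respect to $d$-dimensional Lebesgue measure, that $\int_{\mathcal X}\|x\|\,\mu(dx)<\infty$ with $\|\cdot\|$ the Euclidean norm, and that $\nu=\sum_{j=1}^n\nu_j\delta_{y_j}$ with $n\in\mathbb N$, $y_1,\dots,y_n\in\mathcal Y$ and $\nu_1,\dots,\nu_n\in(0,1]$. A transport map from $\mu$ to $\nu$ is a measurable map $T:\mathcal X\to\mathcal Y$ with $T_\#\mu=\nu$; a transport plan between $\mu$ and $\nu$ is a measure on $\mathcal X\times\mathcal Y$ with marginals $\mu$ and $\nu$. A solution of Monge's problem is a transport map minimizing $\int_{\mathcal X}\|x-T(x)\|\,\mu(dx)$ over all transport maps. A solution of the Monge–Kantorovich problem is a transport plan minimizing $\int_{\mathcal X\times\mathcal Y}\|x-y\|\,\pi(dx,dy)$ over all transport plans, and $W_1(\mu,\nu)$ denotes the infimum of this integral over all transport plans. The coupling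 $\pi_T$ induced by a transport map $T$ is given by $\pi_T(A\times B)=\mu(A\cap T^{-1}(B))$ for all Borel sets $A\subset\mathcal X$, $B\subset\mathcal Y$. Then there is a solution $T_*$ of Monge's problem, and every solution of Monge's problem coincides with $T_*$ $\mu$-almost everywhere. The induced coupling $\pi_{T_*}$ is the unique solution of the Monge–Kantorovich problem. Consequently $$W_1(\mu,\nu)=\int_{\mathcal X}\|x-T_*(x)\|\,\mu(dx)<\infty.$$ -/

import Mathlib

open MeasureTheory
open scoped ENNReal

noncomputable section

namespace SemiDiscreteOT

/-- `ℝ^d` with the Euclidean norm. -/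
abbrev Space (d : ℕ) : Type := EuclideanSpace ℝ (Fin d)

variable {d : ℕ} {X Y : Set (Space d)}

/-- Transport maps from `μ` to `ν`: measurable maps `T : X → Y` with `T_# μ = ν`. -/
def IsTransportMap (μ : Measure X) (ν : Measure Y) (T : X → Y) : Prop :=
  Measurable T ∧ μ.map T = ν

/-- Transport plans (couplings): measures on `X × Y` with marginals `μ` and `ν`. -/
def IsTransportPlan (μ : Measure X) (ν : Measure Y) (π : Measure (X × Y)) : Prop :=
  (∀ A : Set X, MeasurableSet A → π (A ×ˢ Set.univ) = μ A) ∧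
    ∀ B : Set Y, MeasurableSet B → π (Set.univ ×ˢ B) = ν B

/-- The cost of a map, `∫ ‖x - T x‖ dμ`, as an element of `[0, ∞]`. -/
def mapCost (μ : Measure X) (T : X → Y) : ℝ≥0∞ :=
  ∫⁻ x, ‖(x : Space d) - (T x : Space d)‖ₑ ∂μ

/-- The cost of a plan, `∫ ‖x - y‖ dπ`, as an element of `[0, ∞]`. -/
def planCost (π : Measure (X × Y)) : ℝ≥0∞ :=
  ∫⁻ p, ‖(p.1 : Space d) - (p.2 : Space d)‖ₑ ∂π

/-- Solutions of Monge's problem: cost-minimizing transport maps. -/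
def IsMongeSolution (μ : Measure X) (ν : Measure Y) (T : X → Y) : Prop :=
  IsTransportMap μ ν T ∧ ∀ S : X → Y, IsTransportMap μ ν S → mapCost μ T ≤ mapCost μ S

/-- Solutions of the Monge–Kantorovich problem: cost-minimizing transport plans. -/
def IsKantorovichSolution (μ : Measure X) (ν : Measure Y) (π : Measure (X × Y)) : Prop :=
  IsTransportPlan μ ν π ∧
    ∀ σ : Measure (X × Y), IsTransportPlan μ ν σ → planCost π ≤ planCost σ

/-- The Wasserstein distance of order one, with values in `[0, ∞]`. -/
def W₁ (μ : Measure X) (ν : Measure Y) : ℝ≥0∞ :=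
  ⨅ (π : Measure (X × Y)) (_ : IsTransportPlan μ ν π), planCost π

/-- The coupling `π_T` induced by a (measurable) map `T`: the law of `(x, T x)` under `μ`. -/
def inducedPlan (μ : Measure X) (T : X → Y) : Measure (X × Y) :=
  μ.map fun x => (x, T x)

/-- `π_T (A × B) = μ (A ∩ T⁻¹ B)` for all Borel sets `A`, `B`. -/
theorem inducedPlan_prod (μ : Measure X) {T : X → Y} (hT : Measurable T)
    {A : Set X} {B : Set Y} (hA : MeasurableSet A) (hB : MeasurableSet B) :
    inducedPlan μ T (A ×ˢ B) = μ (A ∩ T ⁻¹' B) := by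
  rw [inducedPlan, Measure.map_apply (by fun_prop) (hA.prod hB)]
  rfl

end SemiDiscreteOT

end

/-! The proof is Kantorovich duality with finitely many dual variables. Let `ψ` maximise `∫ minᵢ (‖x
- yᵢ‖ - ψᵢ) dμ + ∑ ψᵢ νᵢ`. Such a `ψ` exists because the functional is continuous and the costs `‖x
- yᵢ‖` differ from one another by bounded amounts, which confines the search to a compact box
(`exists_forall_dualValue_le`). Raising a single `ψᵢ` cannot improve the value, so the closed
Laguerre cell of `yᵢ` has mass at least `νᵢ` (`le_measureReal_cell`).

Two cells meet inside a sheet `‖x - a‖ - ‖x - b‖ = c`, which is null when `d ≥ 2`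
(`volume_dist_sub_dist_eq`); on a line it can be a half-line. Hence the cells are almost disjoint,
their masses are exactly the `νᵢ`, and sending each cell to its atom is a transport map `T`. The
minimum and `ψ` are potentials whose sum is at most the cost, with equality almost surely only on
the graph of `T`. Complementary slackness then places every optimal plan on that graph
(`IsTransportMap.planCost_of_potentials`). -/

namespace SemiDiscreteOT

/-! ### Hyperboloid sheets are Lebesgue null -/

/-- A set meeting every line of direction `v` in finitely many points is Lebesgue null. -/
theorem volume_eq_zero_of_finite_line {d : ℕ} {s : Set (Space d)} (hs : MeasurableSet s)
    (v : Space d) (h : ∀ x : Space d, {t : ℝ | x + t • v ∈ s}.Finite) : volume s = 0 := by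
  have key := ae_mem_of_ae_add_linearMap_mem (LinearMap.toSpanSingleton ℝ (Space d) v)
    (volume : Measure ℝ) (volume : Measure (Space d)) (s := sᶜ) hs.compl (fun x => by
      rw [ae_iff]
      simpa using (h x).measure_zero volume)
  simpa [ae_iff] using key

/-- A real quadratic polynomial with nonzero leading coefficient has finitely many roots. -/
theorem finite_quadratic_zeros {a : ℝ} (ha : a ≠ 0) (b c : ℝ) :
    {t : ℝ | a * t ^ 2 + b * t + c = 0}.Finite := by
  open Polynomial in
  have hp : (C a * X ^ 2 + C b * X + C c : ℝ[X]) ≠ 0 := by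
    intro h
    have := congrArg (fun q : ℝ[X] => q.coeff 2) h
    simp at this
    exact ha this
  refine (Polynomial.finite_setOfPred_isRoot hp).subset fun t ht => ?_
  simpa [Polynomial.IsRoot] using ht

theorem exists_ne_zero_inner_eq_zero {d : ℕ} (hd : 2 ≤ d) (u : Space d) :
    ∃ v : Space d, v ≠ 0 ∧ inner ℝ u v = 0 := by
  have h1 : Module.finrank ℝ (Submodule.span ℝ {u}) ≤ 1 := by simpa using finrank_span_le_card (R := ℝ) ({u} : Set (Space d))
  have h2 := Submodule.finrank_add_finrank_orthogonal (Submodule.span ℝ {u})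
  rw [finrank_euclideanSpace_fin] at h2
  have h3 : (Submodule.span ℝ {u})ᗮ ≠ ⊥ := by
    intro h
    rw [h, finrank_bot] at h2
    omega
  obtain ⟨v, hv, hv0⟩ := Submodule.exists_mem_ne_zero_of_ne_bot h3
  exact ⟨v, hv0, Submodule.mem_orthogonal_singleton_iff_inner_right.1 hv⟩

/-- In dimension at least two, one sheet of a (possibly degenerate) hyperboloid is Lebesgue null. -/
theorem volume_dist_sub_dist_eq {d : ℕ} (hd : 2 ≤ d) {a b : Space d} (hab : a ≠ b) (c : ℝ) :
    volume {x : Space d | ‖x - a‖ - ‖x - b‖ = c} = 0 := by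
  -- Up to a factor 4 this is the leading coefficient of the quadratic satisfied by the intersection
  -- parameters on a line of direction `v`. For `c ≠ 0`, a direction orthogonal to `b - a` serves;
  -- this is where `d ≥ 2` enters.
  have hquad : ∃ v : Space d, inner ℝ (b - a) v ^ 2 - c ^ 2 * ‖v‖ ^ 2 ≠ 0 := by
    by_cases hc : c = 0
    · refine ⟨b - a, ?_⟩
      rw [real_inner_self_eq_norm_sq]
      have : ‖b - a‖ ≠ 0 := norm_ne_zero_iff.2 (sub_ne_zero.2 hab.symm)
      simp [hc, this]
    · obtain ⟨v, hv, hi⟩ := exists_ne_zero_inner_eq_zero hd (b - a)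
      exact ⟨v, by simp [hi, hc, hv]⟩
  obtain ⟨v, hv⟩ := hquad
  refine volume_eq_zero_of_finite_line (measurableSet_eq_fun (by fun_prop) (by fun_prop)) v
    fun x => ?_
  set z := x - b with hz
  set u := b - a with hu
  have hk : ∀ t : ℝ, ‖x + t • v - a‖ ^ 2 =
      ‖z + t • v‖ ^ 2 + 2 * (inner ℝ u z + t * inner ℝ u v) + ‖u‖ ^ 2 := fun t => by
    have : x + t • v - a = (z + t • v) + u := by rw [hz, hu]; abel
    rw [this, norm_add_sq_real, real_inner_comm, inner_add_right, real_inner_smul_right]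
  have hn : ∀ t : ℝ, ‖z + t • v‖ ^ 2 = ‖z‖ ^ 2 + 2 * (t * inner ℝ z v) + t ^ 2 * ‖v‖ ^ 2 :=
    fun t => by
      rw [norm_add_sq_real, real_inner_smul_right, norm_smul, mul_pow, Real.norm_eq_abs, sq_abs]
  set m := 2 * inner ℝ u z + ‖u‖ ^ 2 - c ^ 2 with hm
  refine (finite_quadratic_zeros (mul_ne_zero four_ne_zero hv)
    (4 * inner ℝ u v * m - 8 * c ^ 2 * inner ℝ z v) (m ^ 2 - 4 * c ^ 2 * ‖z‖ ^ 2)).subset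
    fun t ht => ?_
  have ht' : ‖x + t • v - a‖ = ‖z + t • v‖ + c := by
    have : ‖x + t • v - a‖ - ‖x + t • v - b‖ = c := ht
    rw [show x + t • v - b = z + t • v by rw [hz]; abel] at this
    linarith
  -- Squaring once cancels the terms quadratic in `t` outside the norm; squaring again removes the
  -- norm.
  have e1 : 2 * t * inner ℝ u v + m = 2 * c * ‖z + t • v‖ := by
    have := hk t
    rw [ht'] at this
    linarith
  have e2 : (2 * t * inner ℝ u v + m) ^ 2 = 4 * c ^ 2 * ‖z + t • v‖ ^ 2 := by rw [e1]; ring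
  rw [hn] at e2
  simp only [Set.mem_ofPred_eq]
  linarith

end SemiDiscreteOT

/-! ### The dual problem and its maximisers -/

namespace SemiDiscreteOT

section Dual

variable {Ω ι : Type*}

/-- The pointwise minimum of the shifted costs `c i - ψ i`. -/
noncomputable def minShift (c : ι → Ω → ℝ) (ψ : ι → ℝ) (x : Ω) : ℝ := ⨅ i, (c i x - ψ i)

/-- The closed Laguerre cell of `i`: the points at which `c i - ψ i` is minimal. -/
def cell (c : ι → Ω → ℝ) (ψ : ι → ℝ) (i : ι) : Set Ω := {x | ∀ j, c i x - ψ i ≤ c j x - ψ j}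

theorem minShift_le [Finite ι] (c : ι → Ω → ℝ) (ψ : ι → ℝ) (x : Ω) (i : ι) :
    minShift c ψ x ≤ c i x - ψ i :=
  ciInf_le (Set.finite_range _).bddBelow i

theorem le_minShift [Nonempty ι] {c : ι → Ω → ℝ} {ψ : ι → ℝ} {x : Ω} {r : ℝ} (h : ∀ i, r ≤ c i x - ψ i) :
    r ≤ minShift c ψ x :=
  le_ciInf h

theorem measurableSet_cell [Countable ι] [MeasurableSpace Ω] {c : ι → Ω → ℝ}
    (hc : ∀ i, Measurable (c i)) (ψ : ι → ℝ) (i : ι) :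
    MeasurableSet (cell c ψ i) := by
  rw [cell, Set.ofPred_forall]
  exact MeasurableSet.iInter fun j => measurableSet_le (by fun_prop) (by fun_prop)

variable [Fintype ι] [Nonempty ι]

theorem exists_minShift_eq (c : ι → Ω → ℝ) (ψ : ι → ℝ) (x : Ω) :
    ∃ i, c i x - ψ i = minShift c ψ x :=
  exists_eq_ciInf_of_finite

theorem mem_cell_iff {c : ι → Ω → ℝ} {ψ : ι → ℝ} {x : Ω} {i : ι} :
    x ∈ cell c ψ i ↔ minShift c ψ x = c i x - ψ i :=
  ⟨fun h => le_antisymm (minShift_le c ψ x i) (le_minShift h),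
    fun h j => h ▸ minShift_le c ψ x j⟩

theorem exists_mem_cell (c : ι → Ω → ℝ) (ψ : ι → ℝ) (x : Ω) : ∃ i, x ∈ cell c ψ i :=
  (exists_minShift_eq c ψ x).imp fun _ h => mem_cell_iff.2 h.symm

theorem minShift_le_add_dist (c : ι → Ω → ℝ) (ψ ψ' : ι → ℝ) (x : Ω) :
    minShift c ψ x ≤ minShift c ψ' x + dist ψ ψ' := by
  obtain ⟨i, hi⟩ := exists_minShift_eq c ψ' x
  have h1 := minShift_le c ψ x i
  have h2 := dist_le_pi_dist ψ ψ' i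
  rw [Real.dist_eq] at h2
  have h3 := neg_abs_le (ψ i - ψ' i)
  linarith

variable [MeasurableSpace Ω] {c : ι → Ω → ℝ}

variable {μ : Measure Ω} [IsProbabilityMeasure μ]

theorem integrable_minShift (hc : ∀ i, Measurable (c i)) (hi : ∀ i, Integrable (c i) μ)
    (ψ : ι → ℝ) : Integrable (minShift c ψ) μ := by
  have hm : Measurable (minShift c ψ) := Measurable.iInf fun i => (hc i).sub_const _
  refine Integrable.mono' (g := fun x => ∑ i, |c i x - ψ i|)
    (integrable_finsetSum _ fun i _ => ((hi i).sub (integrable_const _)).abs)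
    hm.aestronglyMeasurable (Filter.Eventually.of_forall fun x => ?_)
  obtain ⟨i, h⟩ := exists_minShift_eq c ψ x
  rw [← h, Real.norm_eq_abs]
  exact Finset.single_le_sum (f := fun i => |c i x - ψ i|) (fun _ _ => abs_nonneg _)
    (Finset.mem_univ i)

/-- The dual functional of the semi-discrete transport problem. -/
noncomputable def dualValue (μ : Measure Ω) (c : ι → Ω → ℝ) (p ψ : ι → ℝ) : ℝ :=
  ∫ x, minShift c ψ x ∂μ + ∑ i, ψ i * p i

theorem continuous_dualValue (hc : ∀ i, Measurable (c i)) (hi : ∀ i, Integrable (c i) μ)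
    (p : ι → ℝ) : Continuous (dualValue μ c p) := by
  have h : LipschitzWith 1 fun ψ => ∫ x, minShift c ψ x ∂μ := by
    refine LipschitzWith.of_le_add fun ψ ψ' => ?_
    have := integral_mono (μ := μ) (integrable_minShift hc hi ψ)
      ((integrable_minShift hc hi ψ').add (integrable_const (dist ψ ψ')))
      fun x => minShift_le_add_dist c ψ ψ' x
    rw [integral_add' (integrable_minShift hc hi ψ') (integrable_const _)] at this
    simpa using this
  exact h.continuous.add (by fun_prop)

/-- Every dual variable can be replaced by one in a fixed box without lowering the dual value. -/
theorem exists_box_dualValue_le (hc : ∀ i, Measurable (c i)) (hi : ∀ i, Integrable (c i) μ)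
    {D : ℝ} (hD : ∀ i j x, c i x ≤ c j x + D) {p : ι → ℝ} (hp : ∀ i, 0 ≤ p i)
    (hp1 : ∑ i, p i = 1) (ψ : ι → ℝ) :
    ∃ ψ' ∈ Set.Icc (fun _ : ι => -D) (fun _ => 0), dualValue μ c p ψ ≤ dualValue μ c p ψ' := by
  obtain ⟨k, hk⟩ := Finite.exists_max ψ
  obtain ⟨x₀⟩ : Nonempty Ω := (inferInstance : NeZero μ).out |> fun h => by
    by_contra hn
    rw [not_nonempty_iff] at hn
    exact h (Measure.eq_zero_of_isEmpty μ)
  have hD0 : 0 ≤ D := by linarith [hD k k x₀]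
  -- Subtracting the largest coordinate costs nothing, as `p` has total mass 1. Coordinates below
  -- `-D` can then be raised to `-D`: by `hD`, such an index still does not beat `k`, so the minimum
  -- does not drop.
  refine ⟨fun i => max (ψ i - ψ k) (-D), ⟨fun i => le_max_right _ _, fun i => ?_⟩, ?_⟩
  · exact max_le (by linarith [hk i]) (by linarith)
  have h1 : ∀ x, minShift c ψ x ≤ minShift c (fun i => max (ψ i - ψ k) (-D)) x - ψ k := by
    intro x
    rw [le_sub_iff_add_le]
    refine le_minShift fun i => ?_
    rcases max_cases (ψ i - ψ k) (-D) with ⟨h, -⟩ | ⟨h, -⟩ <;> rw [h]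
    · linarith [minShift_le c ψ x i]
    · linarith [minShift_le c ψ x k, hD k i x]
  have h2 := integral_mono (μ := μ) (integrable_minShift hc hi ψ)
    ((integrable_minShift hc hi _).sub (integrable_const (ψ k))) h1
  rw [integral_sub' (integrable_minShift hc hi _) (integrable_const _)] at h2
  simp only [integral_const, probReal_univ, smul_eq_mul, one_mul] at h2
  have h3 : ∑ i, ψ i * p i ≤ ∑ i, max (ψ i - ψ k) (-D) * p i + ψ k := by
    calc ∑ i, ψ i * p i = ∑ i, (ψ i - ψ k) * p i + ψ k := by
          simp [sub_mul, Finset.sum_sub_distrib, ← Finset.mul_sum, hp1]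
      _ ≤ _ := by
          gcongr with i
          · exact hp i
          · exact le_max_left _ _
  simp only [dualValue]
  linarith

theorem exists_forall_dualValue_le (hc : ∀ i, Measurable (c i)) (hi : ∀ i, Integrable (c i) μ)
    {D : ℝ} (hD : ∀ i j x, c i x ≤ c j x + D) {p : ι → ℝ} (hp : ∀ i, 0 ≤ p i)
    (hp1 : ∑ i, p i = 1) : ∃ ψ, ∀ ψ', dualValue μ c p ψ' ≤ dualValue μ c p ψ := by
  obtain ⟨ψ₀, h₀, -⟩ := exists_box_dualValue_le hc hi hD hp hp1 0
  obtain ⟨ψ, -, hψ⟩ := isCompact_Icc.exists_isMaxOn ⟨ψ₀, h₀⟩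
    (continuous_dualValue hc hi p).continuousOn
  refine ⟨ψ, fun ψ' => ?_⟩
  obtain ⟨ψ'', h, hle⟩ := exists_box_dualValue_le hc hi hD hp hp1 ψ'
  exact hle.trans (hψ h)

/-- At a maximiser of the dual functional, every closed cell has at least the prescribed mass. -/
theorem le_measureReal_cell (hc : ∀ i, Measurable (c i)) (hi : ∀ i, Integrable (c i) μ)
    {p ψ : ι → ℝ} (hψ : ∀ ψ', dualValue μ c p ψ' ≤ dualValue μ c p ψ) (i : ι) :
    p i ≤ μ.real (cell c ψ i) := by
  classical
  let ψt : ℝ → ι → ℝ := fun t => ψ + Pi.single i t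
  have hψi : ∀ t, ψt t i = ψ i + t := fun t => by simp [ψt]
  have hψj : ∀ t j, j ≠ i → ψt t j = ψ j := fun t j h => by simp [ψt, h]
  -- Raising `ψ i` by `t` gains `t * p i` in the sum and loses at most `t` in the integrand, only on
  -- the enlarged cell of `i`.
  have step : ∀ t, 0 < t → p i ≤ μ.real (cell c (ψt t) i) := by
    intro t ht
    have hpt : ∀ x, minShift c ψ x ≤
        minShift c (ψt t) x + (cell c (ψt t) i).indicator (fun _ => t) x := by
      intro x
      by_cases hx : x ∈ cell c (ψt t) i
      · rw [Set.indicator_of_mem hx, mem_cell_iff.1 hx, hψi]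
        linarith [minShift_le c ψ x i]
      · rw [Set.indicator_of_notMem hx, add_zero]
        obtain ⟨j, hj⟩ := exists_mem_cell c (ψt t) x
        have hji : j ≠ i := by rintro rfl; exact hx hj
        rw [mem_cell_iff.1 hj, hψj t j hji]
        exact minShift_le c ψ x j
    have hmeas := measurableSet_cell hc (ψt t) i
    have hint : Integrable ((cell c (ψt t) i).indicator fun _ => t) μ :=
      (integrable_const t).indicator hmeas
    have h1 := integral_mono (μ := μ) (integrable_minShift hc hi ψ)
      ((integrable_minShift hc hi (ψt t)).add hint) hpt
    rw [integral_add' (integrable_minShift hc hi _) hint, integral_indicator_const _ hmeas,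
      smul_eq_mul] at h1
    have h2 : ∑ j, ψt t j * p j = ∑ j, ψ j * p j + t * p i := by
      simp [ψt, add_mul, Finset.sum_add_distrib, Pi.single_apply]
    have h3 := hψ (ψt t)
    simp only [dualValue, h2] at h3
    have : t * p i ≤ t * μ.real (cell c (ψt t) i) := by linarith
    exact le_of_mul_le_mul_left this ht
  -- As `t` decreases to 0 the enlarged cells shrink into the closed cell; continuity from above
  -- passes the bound to the limit.
  let s : ℕ → Set Ω := fun k => cell c (ψt (1 / ((k : ℝ) + 1))) i
  have hanti : Antitone s := by
    intro k l hkl x hx j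
    have hkl' : 1 / ((l : ℝ) + 1) ≤ 1 / ((k : ℝ) + 1) := Nat.one_div_le_one_div hkl
    by_cases hj : j = i
    · rw [hj]
    have := hx j
    rw [hψi, hψj _ _ hj] at this ⊢
    linarith
  have hinter : ⋂ k, s k ⊆ cell c ψ i := by
    intro x hx j
    by_cases hj : j = i
    · rw [hj]
    refine le_of_forall_pos_le_add fun ε hε => ?_
    obtain ⟨k, hk⟩ := exists_nat_one_div_lt hε
    have := Set.mem_iInter.1 hx k j
    rw [hψi, hψj _ _ hj] at this
    linarith
  have hlim := tendsto_measure_iInter_atTop (μ := μ)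
    (s := s)
    (fun k => (measurableSet_cell hc _ i).nullMeasurableSet) hanti
    ⟨0, measure_ne_top _ _⟩
  have hle : p i ≤ μ.real (⋂ k, s k) :=
    ge_of_tendsto ((ENNReal.tendsto_toReal (measure_ne_top μ _)).comp hlim)
      (Filter.Eventually.of_forall fun k => step _ (by positivity))
  exact hle.trans (measureReal_mono hinter)

end Dual

end SemiDiscreteOT

/-! ### From cells to maps; plans, potentials and complementary slackness -/

namespace SemiDiscreteOT

/-- A measurable cover by almost disjoint sets whose masses dominate those of the atoms of a
finitely supported measure `ν` is, up to null sets, the partition into fibres of a map pushing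
`μ` to `ν`. -/
theorem exists_map_eq_of_cells {Ω Z : Type*} [MeasurableSpace Ω] [MeasurableSpace Z]
    [MeasurableSingletonClass Z] {μ : Measure Ω} [IsProbabilityMeasure μ] {ν : Measure Z}
    [IsProbabilityMeasure ν] {S : Finset Z} (hS : ν (S : Set Z)ᶜ = 0) {L : S → Set Ω}
    (hL : ∀ i, MeasurableSet (L i)) (hdisj : ∀ i j, i ≠ j → μ (L i ∩ L j) = 0)
    (hle : ∀ i : S, ν {(i : Z)} ≤ μ (L i)) :
    ∃ T : Ω → Z, Measurable T ∧ μ.map T = ν ∧ ∀ᵐ x ∂μ, ∀ i : S, x ∈ L i → T x = i := by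
  have hne : Nonempty S := by
    by_contra h
    have : S = ∅ := Finset.eq_empty_of_forall_notMem (by simpa using h)
    simp [this] at hS
  let M : S → Set Ω := fun i => L i \ ⋃ j, ⋃ _ : j ≠ i, L j
  have hM : ∀ i, MeasurableSet (M i) := fun i =>
    (hL i).diff (MeasurableSet.iUnion fun j => MeasurableSet.iUnion fun _ => hL j)
  obtain ⟨T, hT, hTM⟩ := exists_measurable_piecewise M hM (fun i _ => (i : Z))
    (fun i => measurable_const) (fun i j hij x hx =>
      (hx.1.2 (Set.mem_iUnion₂.2 ⟨j, hij.symm, hx.2.1⟩)).elim)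
  have hae : ∀ᵐ x ∂μ, ∀ i : S, x ∈ L i → T x = i := by
    have : ∀ᵐ x ∂μ, ∀ i j : S, i ≠ j → ¬ (x ∈ L i ∩ L j) := by
      simp only [ae_all_iff]
      exact fun i j hij => measure_eq_zero_iff_ae_notMem.1 (hdisj i j hij)
    filter_upwards [this] with x hx i hi
    refine hTM i ⟨hi, fun h => ?_⟩
    obtain ⟨j, hj, hxj⟩ := Set.mem_iUnion₂.1 h
    exact hx j i hj ⟨hxj, hi⟩
  refine ⟨T, hT, ?_, hae⟩
  have := Measure.isProbabilityMeasure_map (μ := μ) hT.aemeasurable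
  -- Both measures have total mass 1, so one inequality suffices, and it need only be checked on the
  -- atoms.
  refine (Measure.eq_of_le_of_measure_univ_eq (Measure.le_iff.2 fun B hB => ?_)
    (by simp)).symm
  classical
  have hatom : ∀ z ∈ S, ν {z} ≤ μ.map T {z} := fun z hz => by
    rw [Measure.map_apply hT (measurableSet_singleton z)]
    refine (hle ⟨z, hz⟩).trans (measure_mono_ae ?_)
    filter_upwards [hae] with x hx hxL
    exact hx ⟨z, hz⟩ hxL
  calc ν B ≤ ν ↑(S.filter (· ∈ B)) + ν (S : Set Z)ᶜ := by
        refine (measure_mono fun z hz => ?_).trans (measure_union_le _ _)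
        by_cases h : z ∈ S <;> simp [h, hz]
    _ = ∑ z ∈ S.filter (· ∈ B), ν {z} := by rw [hS, add_zero, sum_measure_singleton]
    _ ≤ ∑ z ∈ S.filter (· ∈ B), μ.map T {z} :=
        Finset.sum_le_sum fun z hz => hatom z (Finset.mem_filter.1 hz).1
    _ = μ.map T ↑(S.filter (· ∈ B)) := by rw [sum_measure_singleton]
    _ ≤ μ.map T B := measure_mono fun z hz => (Finset.mem_filter.1 hz).2

variable {d : ℕ} {X Y : Set (Space d)} {μ : Measure X} {ν : Measure Y}

/-- The Euclidean cost on `X × Y`. -/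
noncomputable def dist₁ (p : X × Y) : ℝ := ‖(p.1 : Space d) - (p.2 : Space d)‖

theorem measurable_dist₁ : Measurable (dist₁ : X × Y → ℝ) := by
  unfold dist₁
  fun_prop

theorem IsTransportPlan.map_fst {π : Measure (X × Y)} (h : IsTransportPlan μ ν π) :
    π.map Prod.fst = μ := by
  ext A hA
  rw [Measure.map_apply measurable_fst hA, ← h.1 A hA, Set.prod_univ]

theorem IsTransportPlan.map_snd {π : Measure (X × Y)} (h : IsTransportPlan μ ν π) :
    π.map Prod.snd = ν := by
  ext B hB
  rw [Measure.map_apply measurable_snd hB, ← h.2 B hB, Set.univ_prod]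

theorem IsTransportMap.isTransportPlan {T : X → Y} (h : IsTransportMap μ ν T) :
    IsTransportPlan μ ν (inducedPlan μ T) := by
  refine ⟨fun A hA => ?_, fun B hB => ?_⟩
  · simp [inducedPlan_prod μ h.1 hA MeasurableSet.univ]
  · rw [inducedPlan_prod μ h.1 MeasurableSet.univ hB, Set.univ_inter, ← h.2,
      Measure.map_apply h.1 hB]

theorem planCost_inducedPlan {T : X → Y} (hT : Measurable T) :
    planCost (inducedPlan μ T) = mapCost μ T := by
  rw [planCost, inducedPlan, lintegral_map (by fun_prop) (by fun_prop), mapCost]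

/-- A plan charging only the graph of `T` is the plan induced by `T`. -/
theorem IsTransportPlan.eq_inducedPlan {π : Measure (X × Y)} (h : IsTransportPlan μ ν π)
    {T : X → Y} (hT : Measurable T) (hae : ∀ᵐ p ∂π, p.2 = T p.1) : π = inducedPlan μ T := by
  calc π = π.map id := Measure.map_id.symm
    _ = π.map ((fun x => (x, T x)) ∘ Prod.fst) :=
        Measure.map_congr (hae.mono fun p hp => Prod.ext rfl hp)
    _ = inducedPlan μ T := by
        rw [← Measure.map_map (by fun_prop) measurable_fst, h.map_fst, inducedPlan]

/-- If `μ` has a finite first moment and `ν` is finitely supported, every plan has finite cost. -/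
theorem IsTransportPlan.integrable_dist₁ [IsProbabilityMeasure ν] {π : Measure (X × Y)}
    (h : IsTransportPlan μ ν π) (hmoment : Integrable (fun x : X => ‖(x : Space d)‖) μ)
    {S : Finset Y} (hS : ν (S : Set Y)ᶜ = 0) : Integrable dist₁ π := by
  have hν : Integrable (fun z : Y => ‖(z : Space d)‖) ν := by
    refine Integrable.of_bound (C := ∑ z ∈ S, ‖(z : Space d)‖) (by fun_prop) ?_
    filter_upwards [measure_eq_zero_iff_ae_notMem.1 hS] with z hz
    rw [norm_norm]
    exact Finset.single_le_sum (f := fun z : Y => ‖(z : Space d)‖) (fun _ _ => norm_nonneg _)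
      (by simpa using hz)
  rw [← h.map_fst] at hmoment
  rw [← h.map_snd] at hν
  refine ((hmoment.comp_measurable measurable_fst).add
    (hν.comp_measurable measurable_snd)).mono' measurable_dist₁.aestronglyMeasurable
    (Filter.Eventually.of_forall fun p => ?_)
  rw [dist₁, norm_norm]
  exact norm_sub_le _ _

theorem planCost_eq_ofReal {π : Measure (X × Y)} (h : Integrable dist₁ π) :
    planCost π = ENNReal.ofReal (∫ p, dist₁ p ∂π) := by
  have := ofReal_integral_norm_eq_lintegral_enorm h
  simpa [planCost, dist₁] using this.symm

/-- The marginals alone determine the integral of a separated function, so a pair of potentials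
gives the same lower bound for the cost of every plan. -/
theorem IsTransportPlan.integral_add {π : Measure (X × Y)} (h : IsTransportPlan μ ν π)
    {φ : X → ℝ} {g : Y → ℝ} (hφ : Integrable φ μ) (hg : Integrable g ν) :
    Integrable (fun p : X × Y => φ p.1 + g p.2) π ∧
      ∫ p, (φ p.1 + g p.2) ∂π = ∫ x, φ x ∂μ + ∫ z, g z ∂ν := by
  rw [← h.map_fst] at hφ ⊢
  rw [← h.map_snd] at hg ⊢
  have h1 := hφ.comp_measurable measurable_fst
  have h2 := hg.comp_measurable measurable_snd
  rw [integral_map measurable_fst.aemeasurable hφ.1, integral_map measurable_snd.aemeasurable hg.1]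
  exact ⟨h1.add h2, MeasureTheory.integral_add h1 h2⟩

/-- Potentials `φ`, `g` with `φ x + g z ≤ ‖x - z‖`, with equality along the graph of a transport
map `T` and at almost no other point, certify that `T` is the unique optimiser. -/
theorem IsTransportMap.planCost_of_potentials [IsProbabilityMeasure ν] {T : X → Y}
    (hT : IsTransportMap μ ν T) (hmoment : Integrable (fun x : X => ‖(x : Space d)‖) μ)
    {S : Finset Y} (hS : ν (S : Set Y)ᶜ = 0) {φ : X → ℝ} {g : Y → ℝ}
    (hφ : Integrable φ μ) (hg : Integrable g ν)
    (hle : ∀ x, ∀ z ∈ S, φ x + g z ≤ dist₁ (x, z))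
    (heq : ∀ᵐ x ∂μ, dist₁ (x, T x) = φ x + g (T x))
    (huniq : ∀ᵐ x ∂μ, ∀ z ∈ S, dist₁ (x, z) = φ x + g z → T x = z)
    {π : Measure (X × Y)} (hπ : IsTransportPlan μ ν π) :
    planCost (inducedPlan μ T) ≤ planCost π ∧
      (planCost π ≤ planCost (inducedPlan μ T) → ∀ᵐ p ∂π, p.2 = T p.1) := by
  have hTi := hT.isTransportPlan.integrable_dist₁ hmoment hS
  have hπi := hπ.integrable_dist₁ hmoment hS
  obtain ⟨ha, hb⟩ := hπ.integral_add hφ hg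
  obtain ⟨ha', hb'⟩ := hT.isTransportPlan.integral_add hφ hg
  have hmT : Measurable fun x => (x, T x) := measurable_id.prodMk hT.1
  have hTeq : ∫ p, dist₁ p ∂(inducedPlan μ T) = ∫ x, φ x ∂μ + ∫ z, g z ∂ν := by
    rw [← hb', inducedPlan, integral_map hmT.aemeasurable hTi.1, integral_map hmT.aemeasurable ha'.1]
    exact integral_congr_ae heq
  have hsupp : ∀ᵐ p ∂π, p.2 ∈ S := by
    have : ∀ᵐ z ∂ν, z ∈ S := by simpa using measure_eq_zero_iff_ae_notMem.1 hS
    rw [← hπ.map_snd] at this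
    exact ae_of_ae_map measurable_snd.aemeasurable this
  have hle' : ∀ᵐ p ∂π, φ p.1 + g p.2 ≤ dist₁ p := hsupp.mono fun p hp => hle p.1 p.2 hp
  have hint := integral_mono_ae ha hπi hle'
  rw [planCost_eq_ofReal hTi, planCost_eq_ofReal hπi, hTeq, ← hb]
  refine ⟨ENNReal.ofReal_le_ofReal hint, fun hopt => ?_⟩
  have hnn : 0 ≤ ∫ p, dist₁ p ∂π := integral_nonneg fun p => norm_nonneg _
  have hopt' : ∫ p, dist₁ p ∂π ≤ ∫ p, (φ p.1 + g p.2) ∂π := by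
    refine (ENNReal.ofReal_le_ofReal_iff ?_).1 hopt
    rw [hb, ← hTeq]
    exact integral_nonneg fun p => norm_nonneg _
  -- Complementary slackness: an almost everywhere inequality with equal integrals is an almost
  -- everywhere equality.
  have hae := (integral_eq_iff_of_ae_le ha hπi hle').1 (le_antisymm hint hopt')
  have huniq' : ∀ᵐ p ∂π, ∀ z ∈ S, dist₁ (p.1, z) = φ p.1 + g z → T p.1 = z := by
    rw [← hπ.map_fst] at huniq
    exact ae_of_ae_map measurable_fst.aemeasurable huniq
  filter_upwards [hae, huniq', hsupp] with p h1 h2 h3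
  exact (h2 p.2 h3 h1.symm).symm

end SemiDiscreteOT

/-! ### Laguerre cells of the Euclidean cost and the main theorem -/

namespace SemiDiscreteOT

variable {d : ℕ} {X Y : Set (Space d)} {μ : Measure X} {ν : Measure Y}

/-- At a common point the two defining inequalities are opposite, so the point lies on a hyperboloid
sheet, which absolute continuity makes `μ`-null. -/
theorem measure_cell_inter_cell (hd : 2 ≤ d)
    (hac : μ.map (fun x : X => (x : Space d)) ≪ volume) {S : Finset Y} (ψ : S → ℝ) {i j : S}
    (hij : i ≠ j) :
    μ (cell (fun (i : S) (x : X) => dist₁ (x, (i : Y))) ψ i ∩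
      cell (fun (i : S) (x : X) => dist₁ (x, (i : Y))) ψ j) = 0 := by
  have hne : ((i : Y) : Space d) ≠ ((j : Y) : Space d) := fun h =>
    hij (Subtype.ext (Subtype.ext h))
  have h0 := hac (volume_dist_sub_dist_eq hd hne (ψ i - ψ j))
  rw [Measure.map_apply measurable_subtype_coe
    (measurableSet_eq_fun (by fun_prop) (by fun_prop))] at h0
  refine measure_mono_null (fun x hx => ?_) h0
  have h1 := hx.1 j
  have h2 := hx.2 i
  simp only [dist₁] at h1 h2
  simp only [Set.mem_preimage, Set.mem_ofPred_eq]
  linarith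

/-- A transport map whose graph is, up to null sets, the unique equality set of a pair of
Kantorovich potentials. -/
theorem exists_transportMap_potentials (hd : 2 ≤ d) [IsProbabilityMeasure μ]
    [IsProbabilityMeasure ν] (hac : μ.map (fun x : X => (x : Space d)) ≪ volume)
    (hmoment : Integrable (fun x : X => ‖(x : Space d)‖) μ) {S : Finset Y}
    (hS : ν (S : Set Y)ᶜ = 0) :
    ∃ (T : X → Y) (φ : X → ℝ) (g : Y → ℝ), IsTransportMap μ ν T ∧ Integrable φ μ ∧
      Integrable g ν ∧ (∀ x, ∀ z ∈ S, φ x + g z ≤ dist₁ (x, z)) ∧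
      (∀ᵐ x ∂μ, dist₁ (x, T x) = φ x + g (T x)) ∧
      ∀ᵐ x ∂μ, ∀ z ∈ S, dist₁ (x, z) = φ x + g z → T x = z := by
  classical
  let c : S → X → ℝ := fun i x => dist₁ (x, (i : Y))
  have hne : Nonempty S := by
    by_contra h
    have : S = ∅ := Finset.eq_empty_of_forall_notMem (by simpa using h)
    simp [this] at hS
  have hc : ∀ i, Measurable (c i) := fun i => measurable_dist₁.comp (by fun_prop)
  have hi : ∀ i, Integrable (c i) μ := fun i => by
    refine (hmoment.add (integrable_const ‖((i : Y) : Space d)‖)).mono'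
      (hc i).aestronglyMeasurable (Filter.Eventually.of_forall fun x => ?_)
    simp only [c, dist₁, norm_norm, Pi.add_apply]
    exact norm_sub_le _ _
  -- By the triangle inequality the costs differ by at most the distance between the two atoms; the
  -- sum over all pairs is a uniform bound.
  have hD : ∀ i j x, c i x ≤
      c j x + ∑ q : S × S, ‖((q.1 : Y) : Space d) - ((q.2 : Y) : Space d)‖ := by
    intro i j x
    have h1 := Finset.single_le_sum
      (f := fun q : S × S => ‖((q.1 : Y) : Space d) - ((q.2 : Y) : Space d)‖)
      (fun _ _ => norm_nonneg _) (Finset.mem_univ (j, i))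
    have h2 := norm_sub_le_norm_sub_add_norm_sub (x : Space d) ((j : Y) : Space d)
      ((i : Y) : Space d)
    simp only [c, dist₁]
    linarith
  have hp1 : ∑ i : S, ν.real {(i : Y)} = 1 := by
    rw [Finset.sum_coe_sort S fun z => ν.real {z}, sum_measureReal_singleton, measureReal_def,
      (prob_compl_eq_zero_iff S.measurableSet).1 hS, ENNReal.toReal_one]
  obtain ⟨ψ, hψ⟩ := exists_forall_dualValue_le hc hi hD (p := fun i : S => ν.real {(i : Y)})
    (fun _ => measureReal_nonneg) hp1
  obtain ⟨T, hT, hTν, hTc⟩ := exists_map_eq_of_cells (μ := μ) hS (measurableSet_cell hc ψ)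
    (fun i j hij => measure_cell_inter_cell hd hac ψ hij)
    (fun i => (ENNReal.toReal_le_toReal (measure_ne_top _ _) (measure_ne_top _ _)).1
      (le_measureReal_cell hc hi hψ i))
  -- The extension of `ψ` by 0 off `S`, written as a sum of indicators so that integrability is
  -- immediate.
  let g : Y → ℝ := fun z => ∑ i : S, ({(i : Y)} : Set Y).indicator (fun _ => ψ i) z
  have hg : ∀ i : S, g i = ψ i := fun i => by
    simp only [g]
    rw [Finset.sum_eq_single i]
    · simp
    · exact fun j _ hj => Set.indicator_of_notMem (fun h => hj (Subtype.ext h.symm)) _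
    · simp
  refine ⟨T, minShift c ψ, g, ⟨hT, hTν⟩, integrable_minShift hc hi ψ,
    integrable_finsetSum _ fun i _ =>
      (integrable_const _).indicator (measurableSet_singleton _), fun x z hz => ?_, ?_, ?_⟩
  · have := minShift_le c ψ x ⟨z, hz⟩
    rw [hg ⟨z, hz⟩]
    simp only [c] at this ⊢
    linarith
  · filter_upwards [hTc] with x hx
    obtain ⟨i, h⟩ := exists_mem_cell c ψ x
    rw [hx i h, hg, mem_cell_iff.1 h]
    simp [c]
  · filter_upwards [hTc] with x hx z hz h
    refine hx ⟨z, hz⟩ (mem_cell_iff.2 ?_)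
    rw [hg ⟨z, hz⟩] at h
    simp only [c]
    linarith

end SemiDiscreteOT

theorem theorem2p1 (d : ℕ) (hd : 2 ≤ d)
    (X Y : Set (SemiDiscreteOT.Space d)) (hX : MeasurableSet X) (hY : MeasurableSet Y)
    (μ : Measure X) (ν : Measure Y) (hμ : IsProbabilityMeasure μ) (hν : IsProbabilityMeasure ν)
    (hac : μ.map (fun x : X => (x : SemiDiscreteOT.Space d)) ≪ volume)
    (hmoment : Integrable (fun x : X => ‖(x : SemiDiscreteOT.Space d)‖) μ)
    (n : ℕ) (y : Fin n → Y) (w : Fin n → ℝ) (hw : ∀ j, w j ∈ Set.Ioc (0 : ℝ) 1)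
    (hνw : ν = ∑ j, ENNReal.ofReal (w j) • Measure.dirac (y j)) :
    ∃ T : X → Y,
      SemiDiscreteOT.IsMongeSolution μ ν T ∧
      (∀ S : X → Y, SemiDiscreteOT.IsMongeSolution μ ν S → S =ᵐ[μ] T) ∧
      SemiDiscreteOT.IsKantorovichSolution μ ν (SemiDiscreteOT.inducedPlan μ T) ∧
      (∀ π : Measure (X × Y), SemiDiscreteOT.IsKantorovichSolution μ ν π →
        π = SemiDiscreteOT.inducedPlan μ T) ∧
      Integrable
        (fun x : X => ‖(x : SemiDiscreteOT.Space d) - (T x : SemiDiscreteOT.Space d)‖) μ ∧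
      SemiDiscreteOT.W₁ μ ν = ENNReal.ofReal
        (∫ x : X, ‖(x : SemiDiscreteOT.Space d) - (T x : SemiDiscreteOT.Space d)‖ ∂μ) := by
  classical
  open SemiDiscreteOT in
  -- The points `y j` may coincide; passing to their image as a finite set merges repeated atoms.
  have hS : ν ((Finset.univ.image y : Finset Y) : Set Y)ᶜ = 0 := by
    rw [hνw, Measure.finsetSum_apply]
    exact Finset.sum_eq_zero fun j _ => by simp
  obtain ⟨T, φ, g, hT, hφ, hg, hle, heq, huniq⟩ :=
    exists_transportMap_potentials hd hac hmoment hS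
  have key := fun {π : Measure (X × Y)} (hπ : IsTransportPlan μ ν π) =>
    hT.planCost_of_potentials hmoment hS hφ hg hle heq huniq hπ
  have hK : IsKantorovichSolution μ ν (inducedPlan μ T) :=
    ⟨hT.isTransportPlan, fun σ hσ => (key hσ).1⟩
  have hM : IsMongeSolution μ ν T := ⟨hT, fun R hR => by
    rw [← planCost_inducedPlan hT.1, ← planCost_inducedPlan hR.1]
    exact (key hR.isTransportPlan).1⟩
  have hTi := hT.isTransportPlan.integrable_dist₁ hmoment hS
  have hmT : Measurable fun x => (x, T x) := measurable_id.prodMk hT.1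
  refine ⟨T, hM, fun R hR => ?_, hK, fun π hπ => ?_, hTi.comp_measurable hmT, ?_⟩
  -- The plan induced by `R` is optimal, hence carried by the graph of `T`; pulling back along `x ↦
  -- (x, R x)` gives `R = T` almost everywhere.
  · have hcost := hR.2 T hT
    rw [← planCost_inducedPlan hT.1, ← planCost_inducedPlan hR.1.1] at hcost
    exact ae_of_ae_map (measurable_id.prodMk hR.1.1).aemeasurable
      ((key hR.1.isTransportPlan).2 hcost)
  · exact hπ.1.eq_inducedPlan hT.1 ((key hπ.1).2 (hπ.2 _ hT.isTransportPlan))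
  · have hW : W₁ μ ν = planCost (inducedPlan μ T) :=
      le_antisymm (iInf₂_le _ hT.isTransportPlan) (le_iInf₂ fun σ hσ => (key hσ).1)
    rw [hW, planCost_eq_ofReal hTi, inducedPlan, integral_map hmT.aemeasurable hTi.1]
    rfl
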